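/- Let $k$ be a field and let $A$ be an associative unital $k$-algebra which is profinite, i.e. isomorphic as a $k$-algebra to the inverse limit of an inverse system (over a nonempty directed index set) of finite-dimensional $k$-algebras. Suppose that $A$ is left or right semiartinian (every nonzero quotient of $A$, as a left module over itself in the first case, or as a right module over itself in the second, contains a simple submodule) and that $A$ is left self-injective ($A$ is injective as a left $A$-module). Then $A$ is finite-dimensional over $k$, and $A$ is a quasi-Frobenius (QF) ring, i.e. $A$ is left and right artinian and left and right self-injective. -/

import Mathlib

universe u v

/-- An inverse system of finite-dimensional (associative, unital) `k`-algebras, indexed by a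
nonempty directed preordered set. -/
structure FiniteDimInverseSystem (k : Type u) [Field k] where
  /-- the index set -/
  ι : Type v
  [preorder : Preorder ι]
  [nonempty : Nonempty ι]
  directed : ∀ i j : ι, ∃ l : ι, i ≤ l ∧ j ≤ l
  /-- the algebras of the system -/
  B : ι → Type v
  [ring : ∀ i, Ring (B i)]
  [algebra : ∀ i, Algebra k (B i)]
  [finite : ∀ i, FiniteDimensional k (B i)]
  /-- the transition morphisms -/
  map : ∀ {i j : ι}, i ≤ j → (B j →ₐ[k] B i)
  map_id : ∀ (i : ι) (x : B i), map (le_refl i) x = x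
  map_comp : ∀ {i j l : ι} (hij : i ≤ j) (hjl : j ≤ l) (x : B l),
    map hij (map hjl x) = map (hij.trans hjl) x

namespace FiniteDimInverseSystem

attribute [instance] preorder nonempty ring algebra finite

/-- The inverse limit of the system: the subalgebra of compatible families in the product. -/
def limit {k : Type u} [Field k] (S : FiniteDimInverseSystem.{u, v} k) :
    Subalgebra k (∀ i, S.B i) where
  carrier := {x | ∀ ⦃i j : S.ι⦄ (h : i ≤ j), S.map h (x j) = x i}
  mul_mem' := by
    intro a b ha hb i j h
    simp [ha h, hb h]
  add_mem' := by
    intro a b ha hb i j h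
    simp [ha h, hb h]
  algebraMap_mem' := by
    intro r i j h
    simp

end FiniteDimInverseSystem

/-- A `k`-algebra is profinite if it is isomorphic, as a `k`-algebra, to an inverse limit of
finite-dimensional `k`-algebras. No topology is part of the data. (Taking the system in the universe
of `A` is no restriction, since its algebras may be replaced by the images of `A` in them, and its
index set by the set of kernels of these projections.) -/
def IsProfiniteAlgebra (k : Type u) [Field k] (A : Type v) [Ring A] [Algebra k A] : Prop :=
  ∃ S : FiniteDimInverseSystem.{u, v} k, Nonempty (A ≃ₐ[k] S.limit)

/-- A module is semiartinian if each of its nonzero quotients contains a simple submodule. -/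
def IsSemiartinianModule (R : Type*) [Ring R] (M : Type*) [AddCommGroup M] [Module R M] : Prop :=
  ∀ N : Submodule R M, N ≠ ⊤ → ∃ T : Submodule R (M ⧸ N), IsSimpleModule R T

/-- A ring is left semiartinian if it is semiartinian as a left module over itself
(equivalently, every nonzero left module has a simple submodule). -/
def IsLeftSemiartinian (R : Type*) [Ring R] : Prop := IsSemiartinianModule R R

/-- A ring is right semiartinian if it is semiartinian as a right module over itself; right
`R`-modules are modules over the opposite ring. -/
def IsRightSemiartinian (R : Type*) [Ring R] : Prop := IsSemiartinianModule Rᵐᵒᵖ R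

/-- A ring is left self-injective if it is injective as a left module over itself. -/
def IsLeftSelfInjective (R : Type*) [Ring R] : Prop := Module.Injective R R

/-- A ring is right self-injective if it is injective as a right module over itself. -/
def IsRightSelfInjective (R : Type*) [Ring R] : Prop := Module.Injective Rᵐᵒᵖ R

/-- A quasi-Frobenius ring: self-injective and artinian, on both sides. (It is a classical theorem
that one of the two sides, chosen independently for each of the two properties, is enough; the
definition asks for both.) -/
structure IsQuasiFrobeniusRing (R : Type*) [Ring R] : Prop where
  left_artinian : IsArtinian R R
  right_artinian : IsArtinian Rᵐᵒᵖ R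
  left_selfInjective : IsLeftSelfInjective R
  right_selfInjective : IsRightSelfInjective R

/-!
Write `J` for the Jacobson radical, `S` for the left socle, and `I i` for the kernels of the
projections from `A` to the algebras of the inverse system; an ideal is open if it contains
some `I i`.

*Finite dimension.* `J` is open (`IsProfiniteFiltration.exists_le_jacobson`): otherwise `A` maps onto
an infinite product of nonzero algebras, which is not semiartinian on either side. The left socle
is essential. This is clear if `A` is left semiartinian. If `A` is right semiartinian, sequences in
`J` are T-nilpotent (Bass), and a Baire category argument, which uses that `A` is linearly compact,
makes `J` nilpotent (`IsProfiniteFiltration.isNilpotent_jacobson`); then each nonzero left ideal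
contains a nonzero cyclic module over the finite-dimensional algebra `A ⧸ J`. Now left
self-injectivity enters. It gives `S J = 0`, and it makes the map from submodules `L` of `S` to
right annihilators, which are subspaces containing `J`, strictly decreasing. So `S` is artinian, and
`I i ∩ S = 0` for some `i`. As `S` is essential, `I i = 0`, and `A` has finite dimension
(`IsProfiniteFiltration.finiteDimensional`).

*Self-injectivity on the right.* By left self-injectivity right ideals are right annihilators. For
left ideals to be left annihilators, every simple left module must embed in `A`, which amounts
to the left annihilator of `S` being `J`. This is the Nakayama permutation in disguise. On
two-sided ideals `Q ≥ J` the map sending `Q` to the left annihilator of `S Q` strictly reverses the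
order. Its square `h` is strictly increasing and `h J` contains the left annihilator of `S`, so
`h J = J` by the ascending chain condition
(`IsLeftSelfInjective.mem_jacobson_of_mul_leftSocle`). With both double annihilator conditions,
Baer's criterion on the right follows.
-/

/-! ### Profinite algebras and linear compactness -/

/-- A family of two-sided ideals `I i` of a `k`-algebra `A` which is a neighbourhood basis of zero
for a profinite topology: downward directed, of finite codimension, with zero intersection.
Completeness is recorded through the two consequences used below: `1 - x` is invertible if `x` is
nilpotent modulo each `I i`, and a sequence converges if it is Cauchy for a decreasing
sequence of open subspaces. Here a subspace is open if it contains some `I i`. -/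
structure IsProfiniteFiltration (k : Type u) [Field k] {A : Type v} [Ring A] [Algebra k A]
    {ι : Type*} (I : ι → Ideal A) : Prop where
  isTwoSided : ∀ i, (I i).IsTwoSided
  nonempty : Nonempty ι
  directed : ∀ i j, ∃ l, I l ≤ I i ∧ I l ≤ I j
  finite : ∀ i, FiniteDimensional k (A ⧸ I i)
  eq_zero : ∀ x, (∀ i, x ∈ I i) → x = 0
  isUnit_one_sub : ∀ x, (∀ i, ∃ n : ℕ, x ^ n ∈ I i) → IsUnit (1 - x)
  exists_limit : ∀ V : ℕ → Submodule k A, Antitone V →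
    (∀ n, ∃ i, (I i).restrictScalars k ≤ V n) →
    ∀ b : ℕ → A, (∀ n, b (n + 1) - b n ∈ V n) → ∃ a, ∀ n, a - b n ∈ V n

/-- Evaluation at the terms of a Cauchy sequence, glued to one functional on the dual space: on
functionals vanishing on `V n` its value is the evaluation at `b n`. -/
lemma exists_functional_of_cauchy {k A : Type*} [Field k] [AddCommGroup A] [Module k A]
    (V : ℕ → Submodule k A) (hV : Antitone V) (b : ℕ → A) (hb : ∀ n, b (n + 1) - b n ∈ V n) :
    ∃ Φ : Module.Dual k A →ₗ[k] k, ∀ n, ∀ f ∈ (V n).dualAnnihilator, Φ f = f (b n) := by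
  let C : ℕ → Submodule k (Module.Dual k A) := fun n => (V n).dualAnnihilator
  have hC : Monotone C := fun m n h => Submodule.dualAnnihilator_anti (hV h)
  have hstep : ∀ n m, n ≤ m → ∀ f ∈ C n, f (b m) = f (b n) := by
    intro n m hnm f hf
    induction m, hnm using Nat.le_induction with
    | base => rfl
    | succ m hm ih =>
      have h := (Submodule.mem_dualAnnihilator f).1 hf _ (hV hm (hb m))
      rw [map_sub, sub_eq_zero] at h
      rw [h, ih]
  have hmem : ∀ f : Module.Dual k A, f ∈ ⨆ n, C n ↔ ∃ n, f ∈ C n := fun f =>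
    Submodule.mem_iSup_of_directed C hC.directed_le
  have key : ∀ n m f, f ∈ C n → f ∈ C m → f (b n) = f (b m) := by
    intro n m f hn hm
    rcases le_total n m with h | h
    · exact (hstep n m h f hn).symm
    · exact hstep m n h f hm
  choose N hN using fun f : ↥(⨆ n, C n) => (hmem f).1 f.2
  let φ : ↥(⨆ n, C n) →ₗ[k] k :=
    { toFun := fun f => (f : Module.Dual k A) (b (N f))
      map_add' := by
        intro f g
        have hf := hC (le_max_left (N f) (N g)) (hN f)
        have hg := hC (le_max_right (N f) (N g)) (hN g)
        rw [key _ _ _ (hN (f + g)) ((C _).add_mem hf hg), key _ _ _ (hN f) hf,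
          key _ _ _ (hN g) hg]
        rfl
      map_smul' := by
        intro c f
        rw [key _ _ _ (hN (c • f)) ((C _).smul_mem c (hN f))]
        rfl }
  obtain ⟨Φ, hΦ⟩ := LinearMap.exists_extend φ
  refine ⟨Φ, fun n f hf => ?_⟩
  have h1 : f ∈ ⨆ n, C n := (hmem f).2 ⟨n, hf⟩
  have h2 := LinearMap.congr_fun hΦ ⟨f, h1⟩
  exact h2.trans (key _ _ f (hN ⟨f, h1⟩) hf)

/-- The kernels of the projections to the algebras of an inverse system form a profinite
filtration. Completeness is linear compactness: the inverse limit is the full linear dual of the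
space of functionals which factor through some projection. -/
lemma exists_isProfiniteFiltration {k : Type u} [Field k] {A : Type v} [Ring A] [Algebra k A]
    (h : IsProfiniteAlgebra k A) :
    ∃ (ι : Type v) (I : ι → Ideal A), IsProfiniteFiltration k I := by
  obtain ⟨S, ⟨e⟩⟩ := h
  let π : ∀ i, A →ₐ[k] S.B i := fun i =>
    (Pi.evalAlgHom k S.B i).comp (S.limit.val.comp e.toAlgHom)
  have hπ : ∀ {i j : S.ι} (hij : i ≤ j) (x : A), S.map hij (π j x) = π i x :=
    fun hij x => (e x).2 hij
  have hlift : ∀ x : ∀ i, S.B i, (∀ ⦃i j : S.ι⦄ (h : i ≤ j), S.map h (x j) = x i) →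
      ∃ a, ∀ i, π i a = x i := by
    intro x hx
    refine ⟨e.symm ⟨x, hx⟩, fun i => ?_⟩
    change (e (e.symm ⟨x, hx⟩)).1 i = x i
    rw [e.apply_symm_apply]
  have hinj : ∀ x y, (∀ i, π i x = π i y) → x = y := fun x y hxy =>
    e.injective (Subtype.ext (funext hxy))
  refine ⟨S.ι, fun i => RingHom.ker (π i), ⟨fun i => inferInstance, S.nonempty, ?_, ?_, ?_, ?_, ?_⟩⟩
  · intro i j
    obtain ⟨l, hi, hj⟩ := S.directed i j
    refine ⟨l, fun x hx => ?_, fun x hx => ?_⟩ <;>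
    · rw [RingHom.mem_ker] at hx ⊢
      first
        | rw [← hπ hi, hx, map_zero]
        | rw [← hπ hj, hx, map_zero]
  · intro i
    exact Module.Finite.of_injective (Ideal.kerLiftAlg (π i)).toLinearMap
      (Ideal.kerLiftAlg_injective (π i))
  · intro x hx
    exact hinj x 0 fun i => by rw [map_zero]; exact hx i
  · intro x hx
    have hu : ∀ i, IsUnit (π i (1 - x)) := by
      intro i
      obtain ⟨n, hn⟩ := hx i
      rw [map_sub, map_one]
      refine IsNilpotent.isUnit_one_sub ⟨n, ?_⟩
      rw [← map_pow]
      exact hn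
    choose y hy1 hy2 using fun i => isUnit_iff_exists.1 (hu i)
    obtain ⟨z, hz⟩ := hlift y (by
      intro i j hij
      have h1 : S.map hij (y j) * π i (1 - x) = 1 := by
        rw [← hπ hij, ← map_mul, hy2, map_one]
      calc S.map hij (y j) = S.map hij (y j) * (π i (1 - x) * y i) := by rw [hy1, mul_one]
        _ = y i := by rw [← mul_assoc, h1, one_mul])
    refine isUnit_iff_exists.2 ⟨z, hinj _ _ fun i => ?_, hinj _ _ fun i => ?_⟩
    · rw [map_mul, hz, hy1, map_one]
    · rw [map_mul, hz, hy2, map_one]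
  · intro V hV hopen b hb
    obtain ⟨Φ, hΦ⟩ := exists_functional_of_cauchy V hV b hb
    let x : ∀ i, S.B i := fun i =>
      (Module.evalEquiv k (S.B i)).symm (Φ ∘ₗ (π i).toLinearMap.dualMap)
    have hx : ∀ i (f : Module.Dual k (S.B i)), f (x i) = Φ (f ∘ₗ (π i).toLinearMap) := by
      intro i f
      simp only [x, Module.apply_evalEquiv_symm_apply]
      rfl
    obtain ⟨a, ha⟩ := hlift x (by
      intro i j hij
      rw [← sub_eq_zero, ← Module.forall_dual_apply_eq_zero_iff k]
      intro f
      have h1 := hx j (f ∘ₗ (S.map hij).toLinearMap)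
      rw [map_sub, sub_eq_zero, hx i f]
      refine h1.trans (congrArg Φ (LinearMap.ext fun y => ?_))
      exact congrArg f (hπ hij y))
    refine ⟨a, fun n => ?_⟩
    rw [← Subspace.forall_mem_dualAnnihilator_apply_eq_zero_iff (V n)]
    intro f hf
    obtain ⟨i, hi⟩ := hopen n
    have hker : LinearMap.ker (π i).toLinearMap ≤ LinearMap.ker f := fun y hy =>
      (Submodule.mem_dualAnnihilator f).1 hf y (hi hy)
    obtain ⟨g, rfl⟩ : ∃ g : Module.Dual k (S.B i), g ∘ₗ (π i).toLinearMap = f := by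
      have := (LinearMap.range_dualMap_eq_dualAnnihilator_ker (π i).toLinearMap)
      have hf' : f ∈ (LinearMap.ker (π i).toLinearMap).dualAnnihilator :=
        (Submodule.mem_dualAnnihilator f).2 fun y hy => hker hy
      rw [← this] at hf'
      exact hf'
    rw [map_sub, sub_eq_zero]
    rw [← hΦ n _ hf, ← hx]
    exact congrArg g (ha i)

/-! ### The radical of a semiartinian profinite algebra is open -/

/-- An element which generates a simple submodule modulo `N`. -/
lemma exists_generator_of_isSimpleModule_quotient {R M : Type*} [Ring R] [AddCommGroup M]
    [Module R M] {N : Submodule R M} (h : ∃ T : Submodule R (M ⧸ N), IsSimpleModule R T) :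
    ∃ x, x ∉ N ∧ ∀ r : R, r • x ∉ N → ∃ s : R, x - s • r • x ∈ N := by
  obtain ⟨T, hT⟩ := h
  have := IsSimpleModule.nontrivial R T
  obtain ⟨t, ht⟩ := exists_ne (0 : T)
  obtain ⟨x, hx⟩ := Submodule.Quotient.mk_surjective N (t : M ⧸ N)
  refine ⟨x, fun hxN => ht ?_, fun r hr => ?_⟩
  · rw [← Submodule.Quotient.mk_eq_zero, hx] at hxN
    exact Subtype.ext hxN
  · have hrt : r • t ≠ 0 := by
      intro h0
      apply hr
      rw [← Submodule.Quotient.mk_eq_zero, Submodule.Quotient.mk_smul, hx]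
      exact congrArg Subtype.val h0
    obtain ⟨s, hs⟩ := IsSimpleModule.toSpanSingleton_surjective R hrt t
    refine ⟨s, ?_⟩
    rw [← Submodule.Quotient.mk_eq_zero, Submodule.Quotient.mk_sub, Submodule.Quotient.mk_smul,
      Submodule.Quotient.mk_smul, hx, sub_eq_zero]
    exact (congrArg Subtype.val hs).symm

lemma IsLeftSemiartinian.exists_generator {A : Type*} [Ring A] (h : IsLeftSemiartinian A)
    {N : Ideal A} (hN : N ≠ ⊤) :
    ∃ x, x ∉ N ∧ ∀ r : A, r * x ∉ N → ∃ s : A, x - s * (r * x) ∈ N :=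
  exists_generator_of_isSimpleModule_quotient (h N hN)

lemma IsRightSemiartinian.exists_generator {A : Type*} [Ring A] (h : IsRightSemiartinian A)
    {N : Submodule Aᵐᵒᵖ A} (hN : N ≠ ⊤) :
    ∃ x, x ∉ N ∧ ∀ r : A, x * r ∉ N → ∃ s : A, x - x * r * s ∈ N := by
  obtain ⟨x, hx, h'⟩ := exists_generator_of_isSimpleModule_quotient (h N hN)
  refine ⟨x, hx, fun r hr => ?_⟩
  obtain ⟨s, hs⟩ := h' (MulOpposite.op r) hr
  exact ⟨s.unop, hs⟩

lemma Ideal.le_jacobson_of_isUnit_one_sub {A : Type*} [Ring A] {V : Ideal A}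
    (h : ∀ x ∈ V, IsUnit (1 - x)) : V ≤ Ring.jacobson A := by
  intro x hx
  rw [← Ideal.jacobson_bot, Ideal.mem_jacobson_iff]
  intro y
  obtain ⟨z, -, hz⟩ := isUnit_iff_exists.1 (h (-(y * x)) (V.neg_mem (V.mul_mem_left y hx)))
  refine ⟨z, ?_⟩
  rw [sub_neg_eq_add, mul_add, mul_one] at hz
  rw [Ideal.mem_bot, mul_assoc, add_comm (z * _), hz, sub_self]

/-- Modulo the radical of an artinian ring each left ideal is generated by an idempotent, which is a
right identity for it. -/
lemma Ideal.exists_sub_mul_mem_jacobson {B : Type*} [Ring B] [IsArtinianRing B] (Q : Ideal B) :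
    ∃ q ∈ Q, ∀ x ∈ Q, x - x * q ∈ Ring.jacobson B := by
  let f := Ideal.Quotient.mk (Ring.jacobson B)
  obtain ⟨e, he, hQ⟩ := IsSemisimpleRing.ideal_eq_span_idempotent (Q.map f)
  have heQ : e ∈ Q.map f := hQ ▸ Ideal.subset_span rfl
  obtain ⟨q, hq, rfl⟩ := (Ideal.mem_map_iff_of_surjective f Ideal.Quotient.mk_surjective).1 heQ
  refine ⟨q, hq, fun x hx => ?_⟩
  have hx' : f x ∈ Q.map f := Ideal.mem_map_of_mem f hx
  rw [hQ] at hx'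
  obtain ⟨s, hs⟩ := Submodule.mem_span_singleton.1 hx'
  rw [← Ideal.Quotient.eq_zero_iff_mem]
  change f (x - x * q) = 0
  rw [map_sub, map_mul, ← hs, smul_eq_mul, mul_assoc, he.eq, sub_self]

section

variable {k : Type u} [Field k] {A : Type v} [Ring A] [Algebra k A] {ι : Type*} {I : ι → Ideal A}

lemma IsProfiniteFiltration.isArtinianRing_quotient (hI : IsProfiniteFiltration k I) (i : ι)
    [(I i).IsTwoSided] : IsArtinianRing (A ⧸ I i) :=
  have := hI.finite i
  isArtinian_of_tower k inferInstance

/-- A two-sided ideal outside the Jacobson radical of a profinite algebra is outside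
the radical modulo some `I i`. There it has a nonzero image in a semisimple quotient, so it is
comaximal with the right annihilator `P` of that image. -/
lemma IsProfiniteFiltration.exists_comaximal (hI : IsProfiniteFiltration k I) {V : Ideal A}
    (hVt : V.IsTwoSided) (hV : ¬ V ≤ Ring.jacobson A) :
    ∃ P : Ideal A, P.IsTwoSided ∧ P ≠ ⊤ ∧ (∃ i, I i ≤ P) ∧ ∃ v ∈ V, 1 - v ∈ P := by
  obtain ⟨i, v₀, hv₀, hi⟩ : ∃ i, ∃ v ∈ V,
      haveI := hI.isTwoSided i
      Ideal.Quotient.mk (I i) v ∉ Ring.jacobson (A ⧸ I i) := by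
    by_contra! hcon
    refine hV (Ideal.le_jacobson_of_isUnit_one_sub fun x hx => hI.isUnit_one_sub x fun i => ?_)
    have := hI.isTwoSided i
    have := hI.isArtinianRing_quotient i
    obtain ⟨n, hn⟩ := IsArtinianRing.isNilpotent_jacobson_bot (R := A ⧸ I i)
    refine ⟨n, ?_⟩
    rw [← Ideal.Quotient.eq_zero_iff_mem, map_pow]
    have h1 := Ideal.pow_mem_pow (hcon i x hx) n
    rwa [← Ideal.jacobson_bot, hn] at h1
  have := hI.isTwoSided i
  have := hI.isArtinianRing_quotient i
  let f := Ideal.Quotient.mk (I i)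
  let J := Ring.jacobson (A ⧸ I i)
  let P : Ideal A :=
    { carrier := {a | ∀ v ∈ V, f (v * a) ∈ J}
      add_mem' := fun {a b} ha hb v hv => by
        rw [mul_add, map_add]
        exact J.add_mem (ha v hv) (hb v hv)
      zero_mem' := fun v _ => by
        rw [mul_zero, map_zero]
        exact J.zero_mem
      smul_mem' := fun r a ha v hv => by
        rw [smul_eq_mul, ← mul_assoc]
        exact ha _ (hVt.mul_mem_of_left r hv) }
  refine ⟨P, ⟨fun {a} b ha v hv => ?_⟩, fun hP => ?_, ⟨i, fun a ha v hv => ?_⟩, ?_⟩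
  · rw [← mul_assoc, map_mul]
    exact J.mul_mem_right _ (ha v hv)
  · have h1 : (1 : A) ∈ P := hP ▸ Submodule.mem_top
    have h2 := h1 v₀ hv₀
    rw [mul_one] at h2
    exact hi h2
  · rw [Ideal.Quotient.eq_zero_iff_mem.2 ((I i).mul_mem_left v ha)]
    exact J.zero_mem
  · obtain ⟨q, hq, h⟩ := (V.map f).exists_sub_mul_mem_jacobson
    obtain ⟨w, hw, rfl⟩ := (Ideal.mem_map_iff_of_surjective f Ideal.Quotient.mk_surjective).1 hq
    refine ⟨w, hw, fun x hx => ?_⟩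
    rw [mul_sub, mul_one, map_sub, map_mul]
    exact h _ (Ideal.mem_map_of_mem f hx)

/-- If no `I i` is contained in the Jacobson radical, there is an infinite sequence of open proper
ideals `P n`, each comaximal with the intersection of its predecessors. -/
lemma IsProfiniteFiltration.exists_comaximal_seq (hI : IsProfiniteFiltration k I)
    (h : ∀ i, ¬ I i ≤ Ring.jacobson A) :
    ∃ V P : ℕ → Ideal A, Antitone V ∧ (∀ n, ∃ i, I i ≤ V n) ∧ (∀ n, (P n).IsTwoSided) ∧
      (∀ n, P n ≠ ⊤) ∧ (∀ n, V (n + 1) ≤ P n) ∧ ∀ n, ∃ v ∈ V n, 1 - v ∈ P n := by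
  let X := {V : Ideal A // V.IsTwoSided ∧ ∃ i, I i ≤ V}
  have hX : ∀ V : X, ∃ P : Ideal A, P.IsTwoSided ∧ P ≠ ⊤ ∧ (∃ i, I i ≤ P) ∧
      ∃ v ∈ V.1, 1 - v ∈ P := fun V =>
    hI.exists_comaximal V.2.1 fun hle => by
      obtain ⟨i, hi⟩ := V.2.2
      exact h i (hi.trans hle)
  choose P hPt hPtop hPo hPV using hX
  have hopen : ∀ V W : Ideal A, (∃ i, I i ≤ V) → (∃ i, I i ≤ W) → ∃ i, I i ≤ V ⊓ W := by
    rintro V W ⟨i, hi⟩ ⟨j, hj⟩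
    obtain ⟨l, hl, hl'⟩ := hI.directed i j
    exact ⟨l, le_inf (hl.trans hi) (hl'.trans hj)⟩
  let V : ℕ → X := fun n => Nat.rec
    ⟨⊤, inferInstance, hI.nonempty.elim fun i => ⟨i, le_top⟩⟩
    (fun _ W => ⟨W.1 ⊓ P W, ⟨fun b ha => ⟨W.2.1.mul_mem_of_left b ha.1,
      (hPt W).mul_mem_of_left b ha.2⟩⟩, hopen _ _ W.2.2 (hPo W)⟩) n
  exact ⟨fun n => (V n).1, fun n => P (V n), antitone_nat_of_succ_le fun n => inf_le_left,
    fun n => (V n).2.2, fun n => hPt _, fun n => hPtop _, fun n => inf_le_right,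
    fun n => hPV _⟩

/-- The characteristic function of a set `U` of indices, lifted along `A → ∏ n, A ⧸ P n`. -/
lemma IsProfiniteFiltration.exists_charFun (hI : IsProfiniteFiltration k I) {V P : ℕ → Ideal A}
    (hV : Antitone V) (hVo : ∀ n, ∃ i, I i ≤ V n)
    (hVP : ∀ n, V (n + 1) ≤ P n) (hco : ∀ n, ∃ v ∈ V n, 1 - v ∈ P n) (U : Set ℕ) :
    ∃ e, (∀ n ∈ U, 1 - e ∈ P n) ∧ ∀ n ∉ U, e ∈ P n := by
  classical
  choose v hv hvP using hco
  let χ : ℕ → A := fun n => if n ∈ U then 1 else 0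
  let b : ℕ → A := fun n => Nat.rec 0 (fun n e => e + (χ n - e) * v n) n
  have hb : ∀ n, b (n + 1) = b n + (χ n - b n) * v n := fun n => rfl
  obtain ⟨e, he⟩ := hI.exists_limit (fun n => (V n).restrictScalars k) (fun m n h => hV h) hVo b
    (fun n => by
      rw [hb, add_sub_cancel_left]
      exact (V n).mul_mem_left _ (hv n))
  have key : ∀ n, χ n - e ∈ P n := by
    intro n
    have h1 : e - b (n + 1) ∈ P n := hVP n (he (n + 1))
    have h2 : (χ n - b n) * (1 - v n) ∈ P n := (P n).mul_mem_left _ (hvP n)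
    have h3 : χ n - e = (χ n - b n) * (1 - v n) - (e - b (n + 1)) := by
      rw [hb]
      noncomm_ring
    rw [h3]
    exact (P n).sub_mem h2 h1
  refine ⟨e, fun n hn => ?_, fun n hn => ?_⟩
  · have := key n
    rwa [show χ n = 1 from if_pos hn] at this
  · have := key n
    rw [show χ n = 0 from if_neg hn, zero_sub] at this
    exact (P n).neg_mem_iff.1 this

lemma Set.Infinite.exists_subset_infinite_diff {S : Set ℕ} (hS : S.Infinite) :
    ∃ U ⊆ S, U.Infinite ∧ (S \ U).Infinite := by
  have := hS.to_subtype
  obtain ⟨g⟩ : Nonempty (ℕ ⊕ ℕ ↪ S) :=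
    ⟨(Denumerable.eqv (ℕ ⊕ ℕ)).toEmbedding.trans (_root_.Infinite.natEmbedding S)⟩
  let g' : ℕ ⊕ ℕ ↪ ℕ := g.trans (Function.Embedding.subtype _)
  refine ⟨Set.range (g' ∘ Sum.inl), ?_, ?_, ?_⟩
  · rintro _ ⟨n, rfl⟩
    exact (g (Sum.inl n)).2
  · exact Set.infinite_range_of_injective (g'.injective.comp Sum.inl_injective)
  · refine (Set.infinite_range_of_injective (g'.injective.comp Sum.inr_injective)).mono ?_
    rintro _ ⟨n, rfl⟩
    refine ⟨(g (Sum.inr n)).2, ?_⟩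
    rintro ⟨m, hm⟩
    exact Sum.inl_ne_inr (g'.injective hm)

/-- The Jacobson radical of a one-sided semiartinian profinite algebra is open. Otherwise `A`
maps onto an infinite product of algebras; modulo the elements of finite support the product has no
simple submodule on either side, since the support of an element can be split into two infinite
parts. -/
lemma IsProfiniteFiltration.exists_le_jacobson (hI : IsProfiniteFiltration k I)
    (hA : IsLeftSemiartinian A ∨ IsRightSemiartinian A) : ∃ i, I i ≤ Ring.jacobson A := by
  by_contra! h
  obtain ⟨V, P, hV, hVo, hPt, hPtop, hVP, hco⟩ := hI.exists_comaximal_seq h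
  have hchar := hI.exists_charFun hV hVo hVP hco
  have hone : ∀ n, (1 : A) ∉ P n := fun n h1 => hPtop n ((Ideal.eq_top_iff_one _).2 h1)
  -- the elements of finite support
  let fin : Set A := {x | {n | x ∉ P n}.Finite}
  have hadd : ∀ {a b}, a ∈ fin → b ∈ fin → a + b ∈ fin := fun {a b} ha hb =>
    (ha.union hb).subset fun n hn => by
      by_contra hcon
      simp only [Set.mem_union, Set.mem_ofPred_eq, not_or, not_not] at hcon
      exact hn ((P n).add_mem hcon.1 hcon.2)
  have hzero : (0 : A) ∈ fin := by
    simp [fin]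
  have hone' : (1 : A) ∉ fin := fun h1 =>
    Set.infinite_univ (h1.subset fun n _ => hone n)
  have hsplit : ∀ x ∉ fin, ∃ e, e * x ∉ fin ∧ x * e ∉ fin ∧
      (∀ a, x - a * (e * x) ∉ fin) ∧ ∀ a, x - x * e * a ∉ fin := by
    intro x hx
    obtain ⟨U, hU, hUi, hUc⟩ := Set.Infinite.exists_subset_infinite_diff hx
    obtain ⟨e, he, he'⟩ := hchar U
    refine ⟨e, fun h1 => hUi (h1.subset fun n hn hn' => ?_),
      fun h1 => hUi (h1.subset fun n hn hn' => ?_),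
      fun a h1 => hUc (h1.subset fun n hn hn' => ?_),
      fun a h1 => hUc (h1.subset fun n hn hn' => ?_)⟩
    · refine hU hn ?_
      have := (P n).add_mem ((hPt n).mul_mem_of_left x (he n hn)) hn'
      rwa [sub_mul, one_mul, sub_add_cancel] at this
    · refine hU hn ?_
      have := (P n).add_mem ((P n).mul_mem_left x (he n hn)) hn'
      rwa [mul_sub, mul_one, sub_add_cancel] at this
    · refine hn.1 ?_
      have := (P n).add_mem hn'
        ((P n).mul_mem_left a ((hPt n).mul_mem_of_left x (he' n hn.2)))
      rwa [sub_add_cancel] at this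
    · refine hn.1 ?_
      have := (P n).add_mem hn'
        ((hPt n).mul_mem_of_left a ((P n).mul_mem_left x (he' n hn.2)))
      rwa [sub_add_cancel] at this
  rcases hA with hA | hA
  · let N : Ideal A :=
      { carrier := fin
        add_mem' := hadd
        zero_mem' := hzero
        smul_mem' := fun r a ha => ha.subset fun n hn hn' => hn ((P n).mul_mem_left r hn') }
    obtain ⟨x, hx, hs⟩ := hA.exists_generator (N := N) fun h => hone' (h ▸ Submodule.mem_top :
      (1 : A) ∈ N)
    obtain ⟨e, he, -, h1, -⟩ := hsplit x hx
    obtain ⟨s, hs⟩ := hs e he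
    exact h1 s hs
  · let N : Submodule Aᵐᵒᵖ A :=
      { carrier := fin
        add_mem' := hadd
        zero_mem' := hzero
        smul_mem' := fun r a ha => ha.subset fun n hn hn' =>
          hn ((hPt n).mul_mem_of_left r.unop hn') }
    obtain ⟨x, hx, hs⟩ := hA.exists_generator (N := N) fun h => hone' (h ▸ Submodule.mem_top :
      (1 : A) ∈ N)
    obtain ⟨e, -, he, -, h1⟩ := hsplit x hx
    obtain ⟨s, hs⟩ := hs e he
    exact h1 s hs

end

/-! ### Nilpotence of the radical in the right semiartinian case -/

lemma Ring.isUnit_one_sub_of_mem_jacobson {A : Type*} [Ring A] {x : A}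
    (hx : x ∈ Ring.jacobson A) : IsUnit (1 - x) := by
  have hleft : ∀ y ∈ Ring.jacobson A, ∃ z, z * (1 - y) = 1 := by
    intro y hy
    rw [← Ideal.jacobson_bot, Ideal.mem_jacobson_iff] at hy
    obtain ⟨z, hz⟩ := hy (-1)
    refine ⟨z, ?_⟩
    rw [Ideal.mem_bot, sub_eq_zero, mul_neg_one, neg_mul] at hz
    rw [mul_sub, mul_one, sub_eq_neg_add, hz]
  obtain ⟨z, hz⟩ := hleft x hx
  -- the left inverse `z` of `1 - x` is itself of the form `1 - y` with `y` in the radical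
  have hz1 : 1 - -(z * x) = z := by
    rw [mul_sub, mul_one] at hz
    rw [sub_neg_eq_add, ← hz, sub_add_cancel]
  obtain ⟨w, hw⟩ := hleft (-(z * x))
    ((Ring.jacobson A).neg_mem ((Ring.jacobson A).mul_mem_left z hx))
  rw [hz1] at hw
  have hw1 : w = 1 - x := by
    calc w = w * (z * (1 - x)) := by rw [hz, mul_one]
      _ = 1 - x := by rw [← mul_assoc, hw, one_mul]
  exact isUnit_iff_exists.2 ⟨z, by rw [← hw1, hw], hz⟩

/-- Bass: sequences of elements of the radical of a right semiartinian ring are left T-nilpotent. A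
right ideal maximal among those avoiding all partial products contradicts semiartinianity,
as simple right modules are killed by the radical. -/
lemma IsRightSemiartinian.exists_prod_eq_zero {A : Type*} [Ring A] (hA : IsRightSemiartinian A)
    (a : ℕ → A) (ha : ∀ n, a n ∈ Ring.jacobson A) :
    ∃ n, ((List.range n).map a).prod = 0 := by
  by_contra! hcon
  let p : ℕ → A := fun n => ((List.range n).map a).prod
  have hp : ∀ n, p (n + 1) = p n * a n := fun n => List.prod_range_succ a n
  obtain ⟨N, -, hN⟩ := zorn_le_nonempty₀ {N : Submodule Aᵐᵒᵖ A | ∀ n, p n ∉ N} (by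
    intro c hc hchain y hy
    refine ⟨sSup c, fun n hn => ?_, fun z hz => le_sSup hz⟩
    obtain ⟨z, hz, hnz⟩ := (Submodule.mem_sSup_of_directed ⟨y, hy⟩ hchain.directedOn).1 hn
    exact hc hz n hnz) ⊥ (fun n hn => hcon n hn)
  obtain ⟨x, hx, hs⟩ := hA.exists_generator (N := N) fun h => hN.prop 0 (h ▸ Submodule.mem_top)
  -- the simple module generated by `x` modulo `N` is killed by the radical
  have hkill : ∀ j ∈ Ring.jacobson A, x * j ∈ N := by
    intro j hj
    by_contra hxj
    obtain ⟨s, hs⟩ := hs j hxj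
    have hu : IsUnit (1 - j * s) :=
      Ring.isUnit_one_sub_of_mem_jacobson ((Ring.jacobson A).mul_mem_right s hj)
    obtain ⟨t, ht, -⟩ := isUnit_iff_exists.1 hu
    have h1 := N.smul_mem (MulOpposite.op t) hs
    refine hx ?_
    have h2 : (x - x * j * s) * t = x := by
      rw [mul_assoc x, ← mul_one_sub, mul_assoc, ht, mul_one]
    rwa [← h2]
  have hlt : N < N ⊔ Submodule.span Aᵐᵒᵖ {x} := by
    refine lt_of_le_of_ne le_sup_left fun h => hx ?_
    rw [h]
    exact Submodule.mem_sup_right (Submodule.mem_span_singleton_self x)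
  obtain ⟨n, hn⟩ : ∃ n, p n ∈ N ⊔ Submodule.span Aᵐᵒᵖ {x} := by
    by_contra! h
    exact hlt.not_ge (hN.le_of_ge h hlt.le)
  obtain ⟨y, hy, z, hz, hyz⟩ := Submodule.mem_sup.1 hn
  obtain ⟨r, rfl⟩ := Submodule.mem_span_singleton.1 hz
  refine hN.prop (n + 1) ?_
  rw [hp, ← hyz, add_mul]
  refine N.add_mem (N.smul_mem (MulOpposite.op (a n)) hy) ?_
  have h1 := hkill (r.unop * a n) ((Ring.jacobson A).mul_mem_left _ (ha n))
  rwa [← mul_assoc] at h1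

/-- If a product of length `n` vanishes under all perturbations of its factors by elements of an
ideal, then it vanishes with all factors taken from the ideal. -/
lemma Ideal.mul_eq_zero_of_forall_prod_eq_zero {A : Type*} [Ring A] (I : Ideal A) [I.IsTwoSided]
    (n : ℕ) :
    ∀ (c : A) (b : ℕ → A),
      (∀ b' : ℕ → A, (∀ j, b' j - b j ∈ I) → c * ((List.range n).map b').prod = 0) →
      ∀ x ∈ I ^ n, c * x = 0 := by
  induction n with
  | zero =>
    intro c b h x hx
    have h1 := h b fun j => by rw [sub_self]; exact I.zero_mem
    rw [List.range_zero, List.map_nil, List.prod_nil, mul_one] at h1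
    rw [h1, zero_mul]
  | succ n ih =>
    intro c b h x hx
    have hcons : ∀ y, y - b 0 ∈ I → ∀ b' : ℕ → A, (∀ j, b' j - b (j + 1) ∈ I) →
        c * y * ((List.range n).map b').prod = 0 := by
      intro y hy b' hb'
      have h1 := h (fun j => Nat.casesOn j y b') (fun j => by
        cases j with
        | zero => exact hy
        | succ j => exact hb' j)
      rw [List.prod_range_succ'] at h1
      rw [mul_assoc]
      exact h1
    have hI : ∀ y ∈ I, ∀ z ∈ I ^ n, c * (y * z) = 0 := by
      intro y hy z hz
      rw [← mul_assoc]
      refine ih (c * y) (fun j => b (j + 1)) (fun b' hb' => ?_) z hz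
      have h1 := hcons (b 0 + y) (by rwa [add_sub_cancel_left]) b' hb'
      have h2 := hcons (b 0) (by rw [sub_self]; exact I.zero_mem) b' hb'
      rwa [mul_add, add_mul, h2, zero_add] at h1
    rw [Ideal.IsTwoSided.pow_succ] at hx
    refine Submodule.smul_induction_on hx (fun r hr s hs => hI r hr s hs) fun y z hy hz => ?_
    rw [mul_add, hy, hz, add_zero]

section

variable {k : Type u} [Field k] {A : Type v} [Ring A] [Algebra k A] {ι : Type*} {I : ι → Ideal A}

lemma IsProfiniteFiltration.exists_notMem (hI : IsProfiniteFiltration k I) {x : A} (hx : x ≠ 0)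
    (i : ι) : ∃ l, I l ≤ I i ∧ x ∉ I l := by
  obtain ⟨j, hj⟩ : ∃ j, x ∉ I j := by
    by_contra! h
    exact hx (hI.eq_zero x h)
  obtain ⟨l, hl, hl'⟩ := hI.directed i j
  exact ⟨l, hl, fun h => hj (hl' h)⟩

lemma Ideal.prod_sub_prod_mem (L : Ideal A) [L.IsTwoSided] {a b : ℕ → A}
    (h : ∀ j, a j - b j ∈ L) (n : ℕ) :
    ((List.range n).map a).prod - ((List.range n).map b).prod ∈ L := by
  induction n with
  | zero => simp
  | succ n ih =>
    rw [List.prod_range_succ, List.prod_range_succ]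
    have h1 := L.add_mem (L.mul_mem_right (a n) ih)
      (L.mul_mem_left ((List.range n).map b).prod (h n))
    convert h1 using 1
    noncomm_ring

/-- A Baire category argument: T-nilpotence of the open ideal `I i₀` makes some
open ideal nilpotent. Were no power of an open ideal zero, successive perturbations by
smaller and smaller open ideals would converge to a sequence without vanishing products. -/
lemma IsProfiniteFiltration.exists_pow_eq_bot (hI : IsProfiniteFiltration k I) (i₀ : ι)
    (h : ∀ a : ℕ → A, (∀ n, a n ∈ I i₀) → ∃ n, ((List.range n).map a).prod = 0) :
    ∃ i n, I i ^ n = ⊥ := by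
  by_contra! hcon
  have hstep : ∀ (n : ℕ) (q : ι × (ℕ → A)), ∃ q' : ι × (ℕ → A), I q'.1 ≤ I q.1 ∧
      (∀ j, q'.2 j - q.2 j ∈ I q.1) ∧ ((List.range n).map q'.2).prod ∉ I q'.1 := by
    rintro n ⟨i, b⟩
    obtain ⟨b', hb', hne⟩ : ∃ b' : ℕ → A, (∀ j, b' j - b j ∈ I i) ∧
        ((List.range n).map b').prod ≠ 0 := by
      by_contra! h0
      have := hI.isTwoSided i
      refine hcon i n ((Submodule.eq_bot_iff _).2 fun x hx => ?_)
      rw [← one_mul x]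
      exact (I i).mul_eq_zero_of_forall_prod_eq_zero n 1 b
        (fun b' hb' => by rw [one_mul, h0 b' hb']) x hx
    obtain ⟨l, hl, hl'⟩ := hI.exists_notMem hne i
    exact ⟨(l, b'), hl, hb', hl'⟩
  choose F hF1 hF2 hF3 using hstep
  let q : ℕ → ι × (ℕ → A) := fun n => Nat.rec (i₀, 0) F n
  have hanti : Antitone fun n => I (q n).1 := antitone_nat_of_succ_le fun n => hF1 n (q n)
  choose a ha using fun j => hI.exists_limit (fun n => (I (q n).1).restrictScalars k)
    (fun m n hmn => hanti hmn) (fun n => ⟨_, le_rfl⟩) (fun n => (q n).2 j)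
    (fun n => hF2 n (q n) j)
  obtain ⟨n, hn⟩ := h a fun j => by
    have h1 : a j - 0 ∈ I i₀ := ha j 0
    rwa [sub_zero] at h1
  have := hI.isTwoSided (q (n + 1)).1
  have h1 := (I (q (n + 1)).1).prod_sub_prod_mem (fun j => ha j (n + 1)) n
  rw [hn, zero_sub, Ideal.neg_mem_iff] at h1
  exact hF3 n (q n) h1

lemma Ideal.pow_le_of_map_pow_eq_bot {J L : Ideal A} [L.IsTwoSided] {n : ℕ}
    (h : ∀ x ∈ J, Ideal.Quotient.mk L x ∈ Ring.jacobson (A ⧸ L))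
    (hn : Ring.jacobson (A ⧸ L) ^ n = ⊥) : J ^ n ≤ L := by
  suffices h' : ∀ m, ∀ x ∈ J ^ m, Ideal.Quotient.mk L x ∈ Ring.jacobson (A ⧸ L) ^ m by
    intro x hx
    have h1 := h' n x hx
    rw [hn] at h1
    exact Ideal.Quotient.eq_zero_iff_mem.1 h1
  intro m
  induction m with
  | zero =>
    intro x hx
    rw [Submodule.pow_zero, Ideal.one_eq_top]
    trivial
  | succ m ih =>
    intro x hx
    rw [Submodule.pow_succ] at hx ⊢
    refine Submodule.smul_induction_on hx (fun r hr s hs => ?_) fun y z hy hz => ?_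
    · rw [smul_eq_mul, map_mul]
      exact Ideal.mul_mem_mul (ih r hr) (h s hs)
    · rw [map_add]
      exact Ideal.add_mem _ hy hz

/-- The Jacobson radical of a right semiartinian profinite algebra is nilpotent. -/
lemma IsProfiniteFiltration.isNilpotent_jacobson (hI : IsProfiniteFiltration k I)
    (hA : IsRightSemiartinian A) : IsNilpotent (Ring.jacobson A) := by
  obtain ⟨i₀, hi₀⟩ := hI.exists_le_jacobson (Or.inr hA)
  obtain ⟨i, n, hn⟩ := hI.exists_pow_eq_bot i₀ fun a ha =>
    hA.exists_prod_eq_zero a fun j => hi₀ (ha j)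
  have := hI.isTwoSided i
  have := hI.isArtinianRing_quotient i
  obtain ⟨m, hm⟩ := IsSemiprimaryRing.isNilpotent (R := A ⧸ I i)
  have h1 : Ring.jacobson A ^ m ≤ I i := Ideal.pow_le_of_map_pow_eq_bot
    (fun x hx => Ring.le_comap_jacobson (Ideal.Quotient.mk (I i)) hx) hm
  refine ⟨m * n, ?_⟩
  have hpow : ∀ l, Ring.jacobson A ^ (m * l) ≤ (Ring.jacobson A ^ m) ^ l := by
    intro l
    induction l with
    | zero => rfl
    | succ l ih =>
      rw [Nat.mul_succ, Ideal.IsTwoSided.pow_add, Submodule.pow_succ]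
      exact Ideal.mul_mono_left ih
  exact le_bot_iff.1 ((hpow n).trans ((Ideal.pow_right_mono h1 n).trans hn.le))

lemma IsProfiniteFiltration.finite_quotient_jacobson (hI : IsProfiniteFiltration k I) {i : ι}
    (hi : I i ≤ Ring.jacobson A) : FiniteDimensional k (A ⧸ Ring.jacobson A) := by
  have := hI.finite i
  exact Module.Finite.of_surjective ((Submodule.factor hi).restrictScalars k)
    (Submodule.factor_surjective hi)

end

/-! ### The left socle and finite dimensionality -/

/-- The left socle of a ring, as a left ideal. -/
def leftSocle (A : Type*) [Ring A] : Ideal A := sSup {T : Ideal A | IsSimpleModule A T}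

/-- Each nonzero left ideal contains a minimal one; equivalently, the left socle is essential. -/
def HasMinimalLeftIdeals (A : Type*) [Ring A] : Prop :=
  ∀ L : Ideal A, L ≠ ⊥ → ∃ T : Ideal A, IsSimpleModule A T ∧ T ≤ L

section

variable {A : Type v} [Ring A]

lemma isSimpleModule_span_singleton {z : A} (hz : z ≠ 0)
    (h : ∀ r, r * z ≠ 0 → ∃ s, z = s * (r * z)) : IsSimpleModule A (Ideal.span {z}) := by
  refine isSimpleModule_iff_isAtom.2 ⟨fun h0 => hz (Ideal.span_singleton_eq_bot.1 h0), ?_⟩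
  intro b hb
  by_contra hne
  obtain ⟨w, hw, hw0⟩ := Submodule.exists_mem_ne_zero_of_ne_bot hne
  obtain ⟨r, rfl⟩ := Ideal.mem_span_singleton'.1 (hb.le hw)
  obtain ⟨s, hs⟩ := h r hw0
  refine hb.not_ge ((Ideal.span_singleton_le_iff_mem _).2 ?_)
  rw [hs]
  exact b.smul_mem s hw

/-- A simple submodule of `A ⧸ l(x)`, with `l(x)` the left annihilator of `x`, gives a simple left
ideal in `A x`. -/
lemma exists_isSimpleModule_le_of_mem {L : Ideal A} {x : A} (hx : x ∈ L)
    (h : ∃ T : Submodule A (A ⧸ LinearMap.ker (LinearMap.toSpanSingleton A A x)),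
      IsSimpleModule A T) :
    ∃ T : Ideal A, IsSimpleModule A T ∧ T ≤ L := by
  obtain ⟨y, hy, hs⟩ := exists_generator_of_isSimpleModule_quotient h
  simp only [LinearMap.mem_ker, LinearMap.toSpanSingleton_apply, smul_eq_mul] at hy hs
  refine ⟨Ideal.span {y * x}, isSimpleModule_span_singleton hy fun r hr => ?_,
    (Ideal.span_singleton_le_iff_mem _).2 (L.mul_mem_left y hx)⟩
  obtain ⟨s, hs⟩ := hs r (by rwa [mul_assoc])
  refine ⟨s, ?_⟩
  rwa [sub_mul, sub_eq_zero, mul_assoc, mul_assoc] at hs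

lemma ker_toSpanSingleton_ne_top {x : A} (hx : x ≠ 0) :
    LinearMap.ker (LinearMap.toSpanSingleton A A x) ≠ ⊤ := by
  intro h
  have h1 : (1 : A) ∈ LinearMap.ker (LinearMap.toSpanSingleton A A x) := h ▸ Submodule.mem_top
  rw [LinearMap.mem_ker, LinearMap.toSpanSingleton_apply, one_smul] at h1
  exact hx h1

lemma IsLeftSemiartinian.hasMinimalLeftIdeals (hA : IsLeftSemiartinian A) :
    HasMinimalLeftIdeals A := by
  intro L hL
  obtain ⟨x, hx, hx0⟩ := Submodule.exists_mem_ne_zero_of_ne_bot hL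
  exact exists_isSimpleModule_le_of_mem hx (hA _ (ker_toSpanSingleton_ne_top hx0))

lemma hasMinimalLeftIdeals_of_isNilpotent_jacobson [IsArtinian A (A ⧸ Ring.jacobson A)]
    (hJ : IsNilpotent (Ring.jacobson A)) : HasMinimalLeftIdeals A := by
  intro L hL
  obtain ⟨x, hx, hx0⟩ := Submodule.exists_mem_ne_zero_of_ne_bot hL
  have key : ∀ n, ∀ x ∈ L, x ≠ 0 → (∀ a ∈ Ring.jacobson A ^ n, a * x = 0) →
      ∃ z ∈ L, z ≠ 0 ∧ ∀ j ∈ Ring.jacobson A, j * z = 0 := by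
    intro n
    induction n with
    | zero =>
      intro x _ hx0 h
      rw [Submodule.pow_zero, Ideal.one_eq_top] at h
      exact absurd (one_mul x ▸ h 1 Submodule.mem_top) hx0
    | succ n ih =>
      intro x hx hx0 h
      by_cases hj : ∀ j ∈ Ring.jacobson A, j * x = 0
      · exact ⟨x, hx, hx0, hj⟩
      · push Not at hj
        obtain ⟨j, hj, hjx⟩ := hj
        refine ih (j * x) (L.mul_mem_left j hx) hjx fun a ha => ?_
        rw [← mul_assoc]
        exact h _ (by rw [Submodule.pow_succ]; exact Ideal.mul_mem_mul ha hj)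
  obtain ⟨n, hn⟩ := hJ
  obtain ⟨z, hz, hz0, hJz⟩ := key n x hx hx0 fun a ha => by
    rw [hn] at ha
    rw [(Submodule.mem_bot A).1 ha, zero_mul]
  refine exists_isSimpleModule_le_of_mem hz ?_
  have hle : Ring.jacobson A ≤ LinearMap.ker (LinearMap.toSpanSingleton A A z) :=
    fun j hj => hJz j hj
  have : IsArtinian A (A ⧸ LinearMap.ker (LinearMap.toSpanSingleton A A z)) :=
    isArtinian_of_surjective _ (Submodule.factor hle) (Submodule.factor_surjective hle)
  have : Nontrivial (A ⧸ LinearMap.ker (LinearMap.toSpanSingleton A A z)) :=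
    Submodule.Quotient.nontrivial_iff.2 (ker_toSpanSingleton_ne_top hz0)
  obtain ⟨T, hT⟩ := IsAtomic.exists_atom
    (Submodule A (A ⧸ LinearMap.ker (LinearMap.toSpanSingleton A A z)))
  exact ⟨T, isSimpleModule_iff_isAtom.2 hT⟩

lemma HasMinimalLeftIdeals.eq_bot_of_inf_leftSocle_eq_bot (hA : HasMinimalLeftIdeals A)
    {L : Ideal A} (hL : L ⊓ leftSocle A = ⊥) : L = ⊥ := by
  by_contra hne
  obtain ⟨T, hT, hTL⟩ := hA L hne
  have h1 : T ≤ L ⊓ leftSocle A := le_inf hTL (le_sSup hT)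
  rw [hL, le_bot_iff] at h1
  exact (isSimpleModule_iff_isAtom.1 hT).1 h1

lemma IsLeftSelfInjective.exists_mul_right (hA : IsLeftSelfInjective A) {L : Ideal A}
    (f : L →ₗ[A] A) : ∃ t, ∀ x : L, f x = x * t := by
  obtain ⟨g, hg⟩ := Module.Baer.of_injective hA L f
  refine ⟨g 1, fun x => ?_⟩
  rw [← hg x x.2, ← smul_eq_mul, ← map_smul, smul_eq_mul, mul_one]

/-- Finitely generated right ideals of a left self-injective ring are right annihilators. -/
lemma IsLeftSelfInjective.exists_eq_sum_mul (hA : IsLeftSelfInjective A) {n : ℕ} (x : Fin n → A)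
    {y : A} (h : ∀ a, (∀ i, a * x i = 0) → a * y = 0) : ∃ t : Fin n → A, y = ∑ i, x i * t i := by
  let f : A →ₗ[A] (Fin n → A) := LinearMap.toSpanSingleton A (Fin n → A) x
  let g : A →ₗ[A] A := LinearMap.toSpanSingleton A A y
  have hfg : LinearMap.ker f ≤ LinearMap.ker g := fun a ha =>
    h a fun i => congrFun (LinearMap.mem_ker.1 ha) i
  obtain ⟨φ, hφ⟩ := hA.out ((LinearMap.ker f).liftQ f le_rfl)
    (LinearMap.ker_eq_bot.1 (Submodule.ker_liftQ_eq_bot _ _ _ le_rfl))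
    ((LinearMap.ker f).liftQ g hfg)
  refine ⟨fun i => φ (Pi.single i 1), ?_⟩
  have h1 : φ x = y := by
    have := hφ (Submodule.Quotient.mk 1)
    rw [Submodule.liftQ_apply, Submodule.liftQ_apply] at this
    simpa [f, g] using this
  rw [← h1, LinearMap.pi_apply_eq_sum_univ φ x]
  refine Finset.sum_congr rfl fun i _ => ?_
  rw [smul_eq_mul]
  congr 2
  ext j
  simp [Pi.single_apply, eq_comm]

lemma IsLeftSelfInjective.exists_eq_mul (hA : IsLeftSelfInjective A) {x y : A}
    (h : ∀ a, a * x = 0 → a * y = 0) : ∃ t, y = x * t := by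
  obtain ⟨t, ht⟩ := hA.exists_eq_sum_mul (fun _ : Fin 1 => x) fun a ha => h a (ha 0)
  exact ⟨t 0, by simpa using ht⟩

/-- If `A x` is simple and `x j ≠ 0`, then `x = x j t` for some `t` by injectivity, and `1 - j t` is
invertible for `j` in the radical. -/
lemma IsLeftSelfInjective.leftSocle_mul_jacobson (hA : IsLeftSelfInjective A) {x j : A}
    (hx : x ∈ leftSocle A) (hj : j ∈ Ring.jacobson A) : x * j = 0 := by
  have hle : leftSocle A ≤ LinearMap.ker (LinearMap.toSpanSingleton A A j) := by
    refine sSup_le fun T hT x hx => ?_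
    change x * j = 0
    by_contra hne
    obtain ⟨t, ht⟩ := hA.exists_eq_mul (x := x * j) (y := x) fun a ha => by
      by_contra hax
      have : IsSimpleModule A T := hT
      have h0 : a • (⟨x, hx⟩ : T) ≠ 0 := fun h => hax (congrArg Subtype.val h)
      obtain ⟨s, hs⟩ := IsSimpleModule.toSpanSingleton_surjective A h0 ⟨x, hx⟩
      have hs' : s * (a * x) = x := congrArg Subtype.val hs
      apply hne
      rw [← hs', mul_assoc, mul_assoc, ha, mul_zero]
    have h1 : x * (1 - j * t) = 0 := by
      rw [mul_sub, mul_one, ← mul_assoc, ← ht, sub_self]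
    have hu := Ring.isUnit_one_sub_of_mem_jacobson ((Ring.jacobson A).mul_mem_right t hj)
    rw [hu.mul_left_eq_zero] at h1
    exact hne (by rw [h1, zero_mul])
  exact hle hx

lemma leftSocle_mul_mem {x : A} (hx : x ∈ leftSocle A) (b : A) : x * b ∈ leftSocle A := by
  have hle : leftSocle A ≤ Submodule.comap (LinearMap.toSpanSingleton A A b) (leftSocle A) := by
    refine sSup_le fun T hT => ?_
    have : IsSimpleModule A T := hT
    let f : T →ₗ[A] A := (LinearMap.toSpanSingleton A A b).domRestrict T
    rw [← Submodule.map_le_iff_le_comap]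
    have hr : Submodule.map (LinearMap.toSpanSingleton A A b) T = LinearMap.range f :=
      (LinearMap.range_domRestrict T _).symm
    rw [hr]
    rcases LinearMap.injective_or_eq_zero f with h | h
    · exact le_sSup (IsSimpleModule.congr (LinearEquiv.ofInjective f h).symm)
    · rw [h, LinearMap.range_zero]
      exact bot_le
  exact hle hx

instance : (leftSocle A).IsTwoSided := ⟨fun b hx => leftSocle_mul_mem hx b⟩

/-- In a left self-injective ring with essential left socle, an element annihilated by the socle
on the left lies in the radical: `x (1 - a) = 0` has no nonzero solution in the socle,
hence none at all, so `1 - a` is right invertible. -/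
lemma IsLeftSelfInjective.mem_jacobson_of_leftSocle_mul (hA : IsLeftSelfInjective A)
    (hmin : HasMinimalLeftIdeals A) {a : A} (ha : ∀ x ∈ leftSocle A, x * a = 0) :
    a ∈ Ring.jacobson A := by
  have hinv : ∀ b, (∀ x ∈ leftSocle A, x * b = 0) → ∃ t, (1 - b) * t = 1 := by
    intro b hb
    have hker : LinearMap.ker (LinearMap.toSpanSingleton A A (1 - b)) = ⊥ := by
      refine hmin.eq_bot_of_inf_leftSocle_eq_bot ((Submodule.eq_bot_iff _).2 ?_)
      rintro x ⟨hx, hxs⟩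
      have h1 : x * (1 - b) = 0 := hx
      rwa [mul_sub, mul_one, hb x hxs, sub_zero] at h1
    obtain ⟨t, ht⟩ := hA.exists_eq_mul (x := 1 - b) (y := 1) fun c hc => by
      have h1 : c ∈ LinearMap.ker (LinearMap.toSpanSingleton A A (1 - b)) := hc
      rw [hker, Submodule.mem_bot] at h1
      rw [h1, zero_mul]
    exact ⟨t, ht.symm⟩
  have hunit : ∀ b, (∀ x ∈ leftSocle A, x * b = 0) → IsUnit (1 - b) := by
    intro b hb
    obtain ⟨t, ht⟩ := hinv b hb
    have ht1 : 1 - -(b * t) = t := by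
      rw [sub_mul, one_mul] at ht
      rw [sub_neg_eq_add, ← ht, sub_add_cancel]
    obtain ⟨w, hw⟩ := hinv (-(b * t)) fun x hx => by
      rw [mul_neg, ← mul_assoc, hb x hx, zero_mul, neg_zero]
    rw [ht1] at hw
    have hw1 : w = 1 - b := by
      calc w = (1 - b) * t * w := by rw [ht, one_mul]
        _ = 1 - b := by rw [mul_assoc, hw, mul_one]
    exact isUnit_iff_exists.2 ⟨t, ht, by rw [← hw1, hw]⟩
  have hle : Ideal.span {a} ≤ Ring.jacobson A := by
    refine Ideal.le_jacobson_of_isUnit_one_sub fun y hy => ?_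
    obtain ⟨r, rfl⟩ := Ideal.mem_span_singleton'.1 hy
    refine hunit _ fun x hx => ?_
    rw [← mul_assoc]
    exact ha _ (leftSocle_mul_mem hx r)
  exact hle (Ideal.mem_span_singleton_self a)

instance isSemisimpleModule_leftSocle : IsSemisimpleModule A (leftSocle A) := by
  have : leftSocle A = ⨆ T ∈ {T : Ideal A | IsSimpleModule A T}, T := sSup_eq_iSup
  rw [this]
  refine isSemisimpleModule_biSup_of_isSemisimpleModule_submodule fun T hT => ?_
  have : IsSimpleModule A T := hT
  infer_instance

lemma jacobson_mul_leftSocle {j x : A} (hj : j ∈ Ring.jacobson A) (hx : x ∈ leftSocle A) :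
    j * x = 0 :=
  congrArg Subtype.val <| Module.mem_annihilator.1
    (IsSemisimpleModule.jacobson_le_annihilator A (leftSocle A) hj) ⟨x, hx⟩

end

section

variable {k : Type u} [Field k] {A : Type v} [Ring A] [Algebra k A]

/-- The right annihilator of a set, as a subspace. -/
def rightAnnihilator (k : Type u) [Field k] {A : Type v} [Ring A] [Algebra k A] (L : Set A) :
    Submodule k A where
  carrier := {a | ∀ x ∈ L, x * a = 0}
  add_mem' := fun {a b} ha hb x hx => by rw [mul_add, ha x hx, hb x hx, add_zero]
  zero_mem' := fun x _ => mul_zero x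
  smul_mem' := fun c a ha x hx => by rw [mul_smul_comm, ha x hx, smul_zero]

/-- The map from submodules `L` of the left socle to right annihilators is strictly
decreasing, as projections of the socle are right multiplications, and right annihilators of such
`L` contain the radical, which has finite codimension. -/
lemma IsLeftSelfInjective.isArtinian_leftSocle (hA : IsLeftSelfInjective A)
    [FiniteDimensional k (A ⧸ Ring.jacobson A)] : IsArtinian A (leftSocle A) := by
  let J := (Ring.jacobson A).restrictScalars k
  let r : Submodule A (leftSocle A) → Submodule k A := fun L =>
    rightAnnihilator k (Subtype.val '' (L : Set (leftSocle A)))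
  have hJr : ∀ L, J ≤ r L := by
    rintro L j hj _ ⟨x, -, rfl⟩
    exact hA.leftSocle_mul_jacobson x.2 hj
  have hlt : ∀ L L', L < L' → r L' < r L := by
    intro L L' h
    refine lt_of_le_not_ge (fun a ha x hx => ha x (Set.image_mono h.le hx)) fun hle => ?_
    obtain ⟨C, hC⟩ := exists_isCompl L
    obtain ⟨t, ht⟩ := hA.exists_mul_right
      ((leftSocle A).subtype ∘ₗ C.subtype ∘ₗ Submodule.projectionOnto C L hC.symm)
    have ht0 : t ∈ r L := by
      rintro _ ⟨x, hx, rfl⟩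
      rw [← ht x]
      have h0 := (Submodule.projectionOnto_apply_eq_zero_iff hC.symm).2 hx
      rw [LinearMap.comp_apply, LinearMap.comp_apply, h0, map_zero, map_zero]
    refine h.not_ge fun x hx => ?_
    have h1 := hle ht0 x ⟨x, hx, rfl⟩
    rw [← ht x] at h1
    exact (Submodule.projectionOnto_apply_eq_zero_iff hC.symm).1
      (Subtype.ext (Subtype.ext h1))
  have : FiniteDimensional k (A ⧸ J) := ‹FiniteDimensional k (A ⧸ Ring.jacobson A)›
  refine ⟨?_⟩
  refine Subrelation.wf (r := fun L L' => (r L').map J.mkQ < (r L).map J.mkQ) ?_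
    (InvImage.wf (fun L => (r L).map J.mkQ) wellFounded_gt)
  intro L L' h
  refine lt_of_le_not_ge (Submodule.map_mono (hlt L L' h).le) fun hle => (hlt L L' h).not_ge ?_
  have h1 := Submodule.comap_mono (f := J.mkQ) hle
  rwa [Submodule.comap_map_mkQ, Submodule.comap_map_mkQ, sup_eq_right.2 (hJr _),
    sup_eq_right.2 (hJr _)] at h1

/-- The left socle is artinian, so it meets some `I i` trivially; as it is essential, this
`I i` is zero. -/
lemma IsProfiniteFiltration.finiteDimensional {ι : Type*} {I : ι → Ideal A}
    (hI : IsProfiniteFiltration k I) (hinj : IsLeftSelfInjective A)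
    (hmin : HasMinimalLeftIdeals A) [FiniteDimensional k (A ⧸ Ring.jacobson A)] :
    FiniteDimensional k A := by
  have := hinj.isArtinian_leftSocle (k := k)
  let D : ι → Submodule A (leftSocle A) := fun i => Submodule.comap (leftSocle A).subtype (I i)
  have hne : (Set.range D).Nonempty := hI.nonempty.elim fun i => ⟨_, i, rfl⟩
  obtain ⟨_, ⟨i, rfl⟩, hmin'⟩ := IsArtinian.set_has_minimal (Set.range D) hne
  have hbot : D i = ⊥ := by
    refine (Submodule.eq_bot_iff _).2 fun x hx => ?_
    refine Subtype.ext (hI.eq_zero x fun j => ?_)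
    obtain ⟨l, hli, hlj⟩ := hI.directed i j
    have h1 : D l ≤ D i := fun y hy => hli hy
    have h2 : D l = D i := (h1.lt_or_eq).resolve_left (hmin' _ ⟨l, rfl⟩)
    rw [← h2] at hx
    exact hlj hx
  have hIi : I i = ⊥ := hmin.eq_bot_of_inf_leftSocle_eq_bot <|
    (Submodule.eq_bot_iff _).2 fun x hx => by
      have h1 : (⟨x, hx.2⟩ : leftSocle A) ∈ D i := hx.1
      rw [hbot] at h1
      exact congrArg Subtype.val ((Submodule.mem_bot A).1 h1)
  have := hI.finite i
  have hinj' : Function.Injective (I i).mkQ :=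
    LinearMap.ker_eq_bot.1 (by rw [Submodule.ker_mkQ, hIi])
  exact Module.Finite.of_injective ((I i).mkQ.restrictScalars k) hinj'

end

/-! ### Annihilators and self-injectivity on the right -/

section

variable {A : Type v} [Ring A]

/-- Right ideals of a left self-injective right noetherian ring are right annihilators. Right ideals
of `A` are encoded as left ideals of `Aᵐᵒᵖ`. -/
lemma IsLeftSelfInjective.mem_of_annihilator_le [IsNoetherianRing Aᵐᵒᵖ]
    (hA : IsLeftSelfInjective A) (F : Ideal Aᵐᵒᵖ) {y : A}
    (h : ∀ a, (∀ x ∈ F, a * MulOpposite.unop x = 0) → a * y = 0) : MulOpposite.op y ∈ F := by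
  obtain ⟨n, s, rfl⟩ := Submodule.fg_iff_exists_fin_generating_family.1
    (IsNoetherian.noetherian F)
  obtain ⟨t, ht⟩ := hA.exists_eq_sum_mul (fun i => (s i).unop) (y := y) fun a ha => by
    refine h a fun x hx => ?_
    induction hx using Submodule.span_induction with
    | mem x hx =>
      obtain ⟨i, rfl⟩ := hx
      exact ha i
    | zero => exact mul_zero a
    | add x y _ _ hx hy => rw [MulOpposite.unop_add, mul_add, hx, hy, add_zero]
    | smul r x _ hx => rw [smul_eq_mul, MulOpposite.unop_mul, ← mul_assoc, hx, zero_mul]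
  rw [ht, Finset.op_sum]
  refine Submodule.sum_mem _ fun i _ => ?_
  exact Submodule.smul_mem _ (MulOpposite.op (t i)) (Submodule.subset_span ⟨i, rfl⟩)

/-- The left annihilator of the product of the left socle with `Q`, as a left ideal. -/
def leftSocleAnnihilator (Q : Ideal A) : Ideal A where
  carrier := {a | ∀ x ∈ leftSocle A, ∀ q ∈ Q, a * (x * q) = 0}
  add_mem' := fun {a b} ha hb x hx q hq => by rw [add_mul, ha x hx q hq, hb x hx q hq, add_zero]
  zero_mem' := fun x _ q _ => zero_mul _
  smul_mem' := fun r a ha x hx q hq => by rw [smul_eq_mul, mul_assoc, ha x hx q hq, mul_zero]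

instance (Q : Ideal A) : (leftSocleAnnihilator Q).IsTwoSided :=
  ⟨fun {a} b ha x hx q hq => by
    rw [mul_assoc, ← mul_assoc b]
    exact ha _ ((leftSocle A).mul_mem_left b hx) q hq⟩

lemma jacobson_le_leftSocleAnnihilator (Q : Ideal A) :
    Ring.jacobson A ≤ leftSocleAnnihilator Q := fun j hj x hx q _ => by
  rw [← mul_assoc, jacobson_mul_leftSocle hj hx, zero_mul]

lemma leftSocleAnnihilator_antitone {Q Q' : Ideal A} (h : Q ≤ Q') :
    leftSocleAnnihilator Q' ≤ leftSocleAnnihilator Q :=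
  fun _ ha x hx q hq => ha x hx q (h hq)

/-- On two-sided ideals above the radical, `leftSocleAnnihilator` reflects the order. The
annihilators determine the right ideals `S Q`, where `S` is the left socle, and `S Q` determines
`Q` because `A` is semisimple modulo its radical, which is the right annihilator of `S`. -/
lemma IsLeftSelfInjective.le_of_leftSocleAnnihilator_le [IsArtinianRing A]
    [IsNoetherianRing Aᵐᵒᵖ] (hA : IsLeftSelfInjective A) (hmin : HasMinimalLeftIdeals A)
    {Q Q' : Ideal A} [Q.IsTwoSided] (hJ : Ring.jacobson A ≤ Q)
    (h : leftSocleAnnihilator Q ≤ leftSocleAnnihilator Q') : Q' ≤ Q := by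
  obtain ⟨e, he, hQe⟩ := Q.exists_sub_mul_mem_jacobson
  let F : Ideal Aᵐᵒᵖ :=
    Ideal.span {y | ∃ x ∈ leftSocle A, ∃ q ∈ Q, y = MulOpposite.op (x * q)}
  have hF : ∀ y ∈ F, ∀ b, y.unop * b * (1 - e) = 0 := by
    intro y hy
    induction hy using Submodule.span_induction with
    | mem y hy =>
      obtain ⟨x, hx, q, hq, rfl⟩ := hy
      intro b
      have h1 := hQe (q * b) (Q.mul_mem_right b hq)
      rw [← mul_one_sub] at h1
      have h2 := hA.leftSocle_mul_jacobson hx h1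
      simpa only [MulOpposite.unop_op, mul_assoc] using h2
    | zero => intro b; rw [MulOpposite.unop_zero, zero_mul, zero_mul]
    | add y z _ _ hy hz =>
      intro b
      rw [MulOpposite.unop_add, add_mul, add_mul, hy, hz, add_zero]
    | smul r y _ hy =>
      intro b
      have h1 := hy (r.unop * b)
      rwa [← mul_assoc] at h1
  intro q hq
  have hmem : ∀ x ∈ leftSocle A, MulOpposite.op (x * q) ∈ F := fun x hx =>
    hA.mem_of_annihilator_le F fun a ha =>
      h (fun x hx q hq => ha _ (Submodule.subset_span ⟨x, hx, q, hq, rfl⟩)) x hx q hq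
  have h1 : q * (1 - e) ∈ Ring.jacobson A :=
    hA.mem_jacobson_of_leftSocle_mul hmin fun x hx => by
      have h2 := hF _ (hmem x hx) 1
      rwa [mul_one, MulOpposite.unop_op, mul_assoc] at h2
  have h2 := Q.add_mem (hJ h1) (Q.mul_mem_left q he)
  rwa [mul_one_sub, sub_add_cancel] at h2

/-- The left annihilator of the left socle is contained in the radical. It lies in `h J`, where `J`
is the radical and `h`, twice `leftSocleAnnihilator`, preserves and reflects the order of
two-sided ideals above `J`; if `h J` were larger than `J`, the iterates of `h` on `J` would form an
infinite ascending chain. -/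
lemma IsLeftSelfInjective.mem_jacobson_of_mul_leftSocle [IsArtinianRing A]
    [IsNoetherianRing Aᵐᵒᵖ] (hA : IsLeftSelfInjective A) (hmin : HasMinimalLeftIdeals A) {a : A}
    (ha : ∀ x ∈ leftSocle A, a * x = 0) : a ∈ Ring.jacobson A := by
  let h : Ideal A → Ideal A := fun Q => leftSocleAnnihilator (leftSocleAnnihilator Q)
  let C : ℕ → Ideal A := fun n => h^[n] (Ring.jacobson A)
  have hC : ∀ n, C (n + 1) = h (C n) := fun n => Function.iterate_succ_apply' h n _
  have hC' : ∀ n, (C n).IsTwoSided ∧ Ring.jacobson A ≤ C n := by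
    intro n
    cases n with
    | zero => exact ⟨inferInstanceAs (Ring.jacobson A).IsTwoSided, le_rfl⟩
    | succ n =>
      rw [hC]
      exact ⟨inferInstanceAs (leftSocleAnnihilator _).IsTwoSided,
        jacobson_le_leftSocleAnnihilator _⟩
  have hmono : Monotone C := by
    refine monotone_nat_of_le_succ fun n => ?_
    induction n with
    | zero => exact (hC' 1).2
    | succ n ih =>
      rw [hC, hC (n + 1)]
      exact leftSocleAnnihilator_antitone (leftSocleAnnihilator_antitone ih)
  obtain ⟨n, hn⟩ := WellFoundedGT.monotone_chain_condition ⟨C, hmono⟩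
  have hle : C (n + 1) ≤ C n := (hn (n + 1) n.le_succ).ge
  have hdown : ∀ m, C (m + 1) ≤ C m → C 1 ≤ C 0 := by
    intro m
    induction m with
    | zero => exact id
    | succ m ih =>
      intro hm
      refine ih ?_
      have hm' : h (C (m + 1)) ≤ h (C m) := by rwa [← hC, ← hC]
      have := (hC' m).1
      exact hA.le_of_leftSocleAnnihilator_le hmin (hC' m).2
        (hA.le_of_leftSocleAnnihilator_le hmin (jacobson_le_leftSocleAnnihilator _) hm')
  refine hdown n hle fun x hx q _ => ?_
  rw [← mul_assoc, ha x hx, zero_mul]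

/-- A left artinian, right noetherian, left self-injective ring is left Kasch: every simple left
module embeds in it. -/
lemma IsLeftSelfInjective.exists_mul_eq_zero_of_isMaximal [IsArtinianRing A]
    [IsNoetherianRing Aᵐᵒᵖ] (hA : IsLeftSelfInjective A) (hmin : HasMinimalLeftIdeals A)
    (M : Ideal A) [M.IsMaximal] : ∃ y ≠ 0, ∀ m ∈ M, m * y = 0 := by
  obtain ⟨e, he, hMe⟩ := M.exists_sub_mul_mem_jacobson
  have hne : 1 - e ∉ Ring.jacobson A := fun h1 => by
    have h2 := M.add_mem (Ring.jacobson_le_of_isMaximal M h1) he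
    rw [sub_add_cancel] at h2
    exact Ideal.IsMaximal.ne_top ‹_› ((Ideal.eq_top_iff_one M).2 h2)
  obtain ⟨x, hx, hx0⟩ : ∃ x ∈ leftSocle A, (1 - e) * x ≠ 0 := by
    by_contra! h
    exact hne (hA.mem_jacobson_of_mul_leftSocle hmin h)
  refine ⟨(1 - e) * x, hx0, fun m hm => ?_⟩
  rw [← mul_assoc, mul_one_sub]
  exact jacobson_mul_leftSocle (hMe m hm) hx

/-- Left ideals are left annihilators, since the ring is an injective cogenerator. -/
lemma IsLeftSelfInjective.mem_of_forall_mul_eq_zero [IsArtinianRing A]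
    [IsNoetherianRing Aᵐᵒᵖ] (hA : IsLeftSelfInjective A) (hmin : HasMinimalLeftIdeals A)
    (L : Ideal A) {a : A} (h : ∀ y, (∀ x ∈ L, x * y = 0) → a * y = 0) : a ∈ L := by
  by_contra haL
  let f : A →ₗ[A] A ⧸ L := L.mkQ ∘ₗ LinearMap.toSpanSingleton A A a
  have hf : ∀ b, f b = L.mkQ (b * a) := fun b => rfl
  have hne : LinearMap.ker f ≠ ⊤ := fun htop => by
    have h1 : (1 : A) ∈ LinearMap.ker f := htop ▸ Submodule.mem_top
    rw [LinearMap.mem_ker, hf, one_mul, Submodule.mkQ_apply, Submodule.Quotient.mk_eq_zero] at h1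
    exact haL h1
  obtain ⟨M, hM, hle⟩ := Ideal.exists_le_maximal _ hne
  obtain ⟨y, hy0, hy⟩ := hA.exists_mul_eq_zero_of_isMaximal hmin M
  let g : A →ₗ[A] A := LinearMap.toSpanSingleton A A y
  obtain ⟨φ, hφ⟩ := hA.out ((LinearMap.ker f).liftQ f le_rfl)
    (LinearMap.ker_eq_bot.1 (Submodule.ker_liftQ_eq_bot _ _ _ le_rfl))
    ((LinearMap.ker f).liftQ g fun b hb => hy b (hle hb))
  have hmul : ∀ b, φ (L.mkQ b) = b * φ (L.mkQ 1) := fun b => by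
    rw [← smul_eq_mul, ← map_smul, ← map_smul, smul_eq_mul, mul_one]
  have h1 : φ (f 1) = g 1 := hφ (Submodule.Quotient.mk 1)
  rw [hf, one_mul, hmul, LinearMap.toSpanSingleton_apply, one_smul] at h1
  refine hy0 (h1 ▸ h _ fun x hx => ?_)
  rw [← hmul, Submodule.mkQ_apply, (Submodule.Quotient.mk_eq_zero L).2 hx, map_zero]

/-- The double annihilator conditions on both sides give Baer's criterion on the right: a
homomorphism given on two right ideals by left multiplications is given by one left
multiplication on their sum, as `l(F ∩ F') = l(F) + l(F')`. -/
lemma IsLeftSelfInjective.isRightSelfInjective [IsArtinianRing A] [IsNoetherianRing Aᵐᵒᵖ]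
    (hA : IsLeftSelfInjective A) (hmin : HasMinimalLeftIdeals A) : IsRightSelfInjective A := by
  refine Module.Baer.injective fun I g => ?_
  suffices h : ∃ c : A, ∀ x : I, g x = c * (x : Aᵐᵒᵖ).unop by
    obtain ⟨c, hc⟩ := h
    exact ⟨LinearMap.toSpanSingleton Aᵐᵒᵖ A c, fun x hx => (hc ⟨x, hx⟩).symm⟩
  obtain ⟨F, ⟨hF, c, hc⟩, hmax⟩ := set_has_maximal_iff_noetherian.2 ‹IsNoetherianRing Aᵐᵒᵖ›
    {F : Ideal Aᵐᵒᵖ | F ≤ I ∧ ∃ c : A, ∀ x : I, (x : Aᵐᵒᵖ) ∈ F → g x = c * (x : Aᵐᵒᵖ).unop}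
    ⟨⊥, bot_le, 0, fun x hx => by
      rw [zero_mul, show x = 0 from Subtype.ext ((Submodule.mem_bot _).1 hx), map_zero]⟩
  refine ⟨c, fun x => hc x ?_⟩
  by_contra hxF
  have hg : ∀ (y : A) (z : I), g (MulOpposite.op y • z) = g z * y := fun y z => map_smul g _ z
  obtain ⟨b, hb⟩ : ∃ b, b * (x : Aᵐᵒᵖ).unop = g x := by
    refine Ideal.mem_span_singleton'.1 (hA.mem_of_forall_mul_eq_zero hmin _ fun y hy => ?_)
    have h0 : MulOpposite.op y • x = 0 :=
      Subtype.ext (MulOpposite.unop_injective (hy _ (Ideal.mem_span_singleton_self _)))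
    rw [← hg, h0, map_zero]
  let lF : Ideal A :=
    { carrier := {a | ∀ z ∈ F, a * z.unop = 0}
      add_mem' := fun {a b} ha hb z hz => by rw [add_mul, ha z hz, hb z hz, add_zero]
      zero_mem' := fun z _ => zero_mul _
      smul_mem' := fun r a ha z hz => by rw [smul_eq_mul, mul_assoc, ha z hz, mul_zero] }
  let lx : Ideal A := LinearMap.ker (LinearMap.toSpanSingleton A A (x : Aᵐᵒᵖ).unop)
  have hcb : c - b ∈ lF ⊔ lx := by
    refine hA.mem_of_forall_mul_eq_zero hmin _ fun y hy => ?_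
    have hyF : MulOpposite.op y ∈ F := hA.mem_of_annihilator_le F fun a ha =>
      hy a (Submodule.mem_sup_left ha)
    obtain ⟨w, hw⟩ := hA.exists_eq_mul (x := (x : Aᵐᵒᵖ).unop) (y := y) fun a ha =>
      hy a (Submodule.mem_sup_right ha)
    have hwx : ((MulOpposite.op w • x : I) : Aᵐᵒᵖ) = MulOpposite.op y :=
      MulOpposite.unop_injective hw.symm
    have h1 := hc (MulOpposite.op w • x) (hwx ▸ hyF)
    rw [hwx, hg, ← hb, MulOpposite.unop_op] at h1
    rw [sub_mul, ← h1, hw, mul_assoc, sub_self]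
  obtain ⟨u, hu, v, hv, huv⟩ := Submodule.mem_sup.1 hcb
  have hv' : v * (x : Aᵐᵒᵖ).unop = 0 := hv
  refine hmax (F ⊔ Ideal.span {(x : Aᵐᵒᵖ)})
    ⟨sup_le hF ((Ideal.span_singleton_le_iff_mem _).2 x.2), c - u, fun z hz => ?_⟩
    (lt_of_le_of_ne le_sup_left fun h => hxF ?_)
  · obtain ⟨z₁, hz₁, z₂, hz₂, hz⟩ := Submodule.mem_sup.1 hz
    obtain ⟨r, rfl⟩ := Ideal.mem_span_singleton'.1 hz₂
    have hzx : z = ⟨z₁, hF hz₁⟩ + MulOpposite.op r.unop • x := Subtype.ext hz.symm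
    have h1 : c - u = b + v := by
      rw [sub_eq_iff_eq_add, add_assoc, add_comm v u, huv, add_sub_cancel]
    have h2 : (c - u) * z₁.unop = g ⟨z₁, hF hz₁⟩ := by
      rw [sub_mul, hu z₁ hz₁, sub_zero, hc ⟨z₁, hF hz₁⟩ hz₁]
    have h3 : (c - u) * (x : Aᵐᵒᵖ).unop = g x := by
      rw [h1, add_mul, hv', add_zero, hb]
    rw [← hz, MulOpposite.unop_add, MulOpposite.unop_mul, mul_add, ← mul_assoc, h2, h3, hzx,
      map_add, hg]
  · rw [h]
    exact Submodule.mem_sup_right (Ideal.mem_span_singleton_self _)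

end

theorem theorem5p2 (k : Type u) [Field k] (A : Type v) [Ring A] [Algebra k A]
    (hprofinite : IsProfiniteAlgebra k A)
    (hsemiartinian : IsLeftSemiartinian A ∨ IsRightSemiartinian A)
    (hinjective : IsLeftSelfInjective A) :
    FiniteDimensional k A ∧ IsQuasiFrobeniusRing A := by
  obtain ⟨ι, I, hI⟩ := exists_isProfiniteFiltration hprofinite
  obtain ⟨i, hi⟩ := hI.exists_le_jacobson hsemiartinian
  have := hI.finite_quotient_jacobson hi
  have : IsArtinian A (A ⧸ Ring.jacobson A) := isArtinian_of_tower k inferInstance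
  have hmin : HasMinimalLeftIdeals A := hsemiartinian.elim
    (fun h => h.hasMinimalLeftIdeals)
    (fun h => hasMinimalLeftIdeals_of_isNilpotent_jacobson (hI.isNilpotent_jacobson h))
  have hfin : FiniteDimensional k A := hI.finiteDimensional hinjective hmin
  have : IsArtinianRing A := isArtinian_of_tower k inferInstance
  have : IsNoetherianRing Aᵐᵒᵖ := isNoetherian_of_tower k inferInstance
  exact ⟨hfin, inferInstance, isArtinian_of_tower k inferInstance, hinjective,
    hinjective.isRightSelfInjective hmin⟩
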